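/- Work over $\mathbb{C}$. Let $r\ge 1$, let $\mathbf{n}=(n_1,\dots,n_r)$ and $\mathbf{d}=(d_1,\dots,d_r)$ be $r$-tuples of positive integers with $n_1\le\dots\le n_r$, and let $SV^{\mathbf{n}}_{\mathbf{d}}\subset\mathbb{P}^N$, $N=\prod_{i=1}^r\binom{n_i+d_i}{d_i}-1$, be the Segre–Veronese variety, i.e. $\mathbb{P}^{n_1}\times\dots\times\mathbb{P}^{n_r}$ embedded by the complete linear system $|\mathcal{O}(d_1,\dots,d_r)|$ (by all monomials of multidegree $(d_1,\dots,d_r)$). For an irreducible variety $X\subset\mathbb{P}^N$, a point $x\in X$ and a hyperplane $H\supseteq T_xX$ (the embedded tangent space), the contact locus $\Sigma_{x,H}$ is the union of the irreducible components containing $x$ of the locus $\{y\in X : T_yX\subseteq H\}$ of points at which $H$ is tangent to $X$ (for smooth $X\not\subseteq H$ this locus is $\mathrm{Sing}(X\cap H)$). The variety $X$ is called $1$-weakly defective if $\dim\Sigma_{x,H}>0$ for a general point $x\in X$ and a general hyperplane $H$ containing $T_xX$; here "general" means in a nonempty Zariski open subset of $X$, respectively of the linear system of hyperplanes containing $T_xX$.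 If $n_r\le n_1+\dots+n_{r-1}$, then $SV^{\mathbf{n}}_{\mathbf{d}}$ is not $1$-weakly defective; more precisely, for general $x\in SV^{\mathbf{n}}_{\mathbf{d}}$ and a general hyperplane $H\supseteq T_xSV^{\mathbf{n}}_{\mathbf{d}}$ one has $\dim\Sigma_{x,H}=0$. -/

import Mathlib

noncomputable section

/-- Complex projective space with homogeneous coordinates indexed by `ι`
(a type of its own, so that it can carry the Zariski topology). -/
def ProjSpace (ι : Type) : Type := Projectivization ℂ (ι → ℂ)

namespace ProjSpace

variable {ι : Type}

/-- The point `[v]` of projective space. -/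
def mk (v : ι → ℂ) (hv : v ≠ 0) : ProjSpace ι := Projectivization.mk ℂ v hv

/-- A vector of homogeneous coordinates of a point. -/
def coords (p : ProjSpace ι) : ι → ℂ := Projectivization.rep p

/-- The Zariski topology: the sets `{F ≠ 0}`, `F` a homogeneous polynomial, are a basis of
open sets. -/
instance : TopologicalSpace (ProjSpace ι) :=
  TopologicalSpace.generateFrom
    {U | ∃ (F : MvPolynomial ι ℂ) (k : ℕ), F.IsHomogeneous k ∧
      U = {p | MvPolynomial.eval p.coords F ≠ 0}}

end ProjSpace

open ProjSpace

/-- `P a` holds for the general point `a` of the (irreducible) set `S`: it holds on a nonempty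
relatively open subset of `S`. -/
def ForGeneral {α : Type} [TopologicalSpace α] (S : Set α) (P : α → Prop) : Prop :=
  ∃ U : Set α, IsOpen U ∧ (S ∩ U).Nonempty ∧ ∀ a ∈ S ∩ U, P a

section Projective

variable {ι : Type} [Fintype ι]

/-- The embedded tangent space `T_y X` of `X ⊆ ℙ^N` at `y`, as a linear subspace of `ℂ^(N+1)`:
the common zeros of the differentials at `y` of the homogeneous polynomials vanishing on `X`. -/
def embeddedTangentSpace (X : Set (ProjSpace ι)) (y : ProjSpace ι) : Submodule ℂ (ι → ℂ) where
  carrier := {w | ∀ (F : MvPolynomial ι ℂ) (k : ℕ), F.IsHomogeneous k →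
    (∀ q ∈ X, MvPolynomial.eval q.coords F = 0) →
    ∑ j, MvPolynomial.eval y.coords (MvPolynomial.pderiv j F) * w j = 0}
  zero_mem' := by
    intro F k _ _
    simp
  add_mem' := by
    intro a b ha hb F k hF hX
    simp only [Pi.add_apply, mul_add, Finset.sum_add_distrib, ha F k hF hX, hb F k hF hX,
      add_zero]
  smul_mem' := by
    intro c a ha F k hF hX
    simp only [Pi.smul_apply, smul_eq_mul, mul_left_comm _ c, ← Finset.mul_sum, ha F k hF hX,
      mul_zero]

/-- The linear subspace of `ℂ^(N+1)` underlying the hyperplane `∑ a_j X_j = 0`. Hyperplanes of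
`ℙ^N` are the points `a` of the dual projective space. -/
def hyperplane (a : ProjSpace ι) : Submodule ℂ (ι → ℂ) where
  carrier := {w | ∑ j, a.coords j * w j = 0}
  zero_mem' := by simp
  add_mem' := by
    intro u v hu hv
    simp only [Set.mem_ofPred_eq, Pi.add_apply, mul_add, Finset.sum_add_distrib] at *
    rw [hu, hv, add_zero]
  smul_mem' := by
    intro c u hu
    simp only [Set.mem_ofPred_eq, Pi.smul_apply, smul_eq_mul, mul_left_comm _ c,
      ← Finset.mul_sum] at *
    rw [hu, mul_zero]

/-- The linear system of the hyperplanes tangent to `X` at `y`, i.e. containing `T_y X`. -/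
def tangentHyperplanes (X : Set (ProjSpace ι)) (y : ProjSpace ι) : Set (ProjSpace ι) :=
  {H | embeddedTangentSpace X y ≤ hyperplane H}

/-- The locus of points of `X` at which the hyperplane `H` is tangent to `X`; for smooth `X` not
contained in `H` this is the singular locus of the hyperplane section `X ∩ H`. -/
def tangencyLocus (X : Set (ProjSpace ι)) (H : ProjSpace ι) : Set (ProjSpace ι) :=
  {y | y ∈ X ∧ H ∈ tangentHyperplanes X y}

/-- The contact locus of `X` with respect to `x` and `H`: the union of the irreducible components
of the tangency locus of `H` that contain `x`. -/
def contactLocus (X : Set (ProjSpace ι)) (x H : ProjSpace ι) : Set (ProjSpace ι) :=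
  ⋃₀ {Z | Maximal (fun Y => IsIrreducible Y ∧ Y ⊆ tangencyLocus X H) Z ∧ x ∈ Z}

/-- `X` is `1`-weakly defective: for `x` a general point of `X` and `H` a general hyperplane
containing `T_x X`, the contact locus has positive dimension. -/
def IsOneWeaklyDefective (X : Set (ProjSpace ι)) : Prop :=
  ForGeneral X fun x => ForGeneral (tangentHyperplanes X x) fun H =>
    0 < topologicalKrullDim (contactLocus X x H)

end Projective

section SegreVeronese

variable {m : ℕ} (n d : Fin m → ℕ)

/-- The index set of the monomials of multidegree `(d_1, …, d_m)`: for each factor, a multiset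
of `d_i` indices in `{0, …, n_i}`. -/
abbrev SVIndex : Type := (i : Fin m) → Sym (Fin (n i + 1)) (d i)

/-- The vector of all monomials of multidegree `(d_1, …, d_m)`, evaluated at `x`. -/
def svVec (x : (i : Fin m) → Fin (n i + 1) → ℂ) : SVIndex n d → ℂ :=
  fun J => ∏ i, ((J i : Multiset (Fin (n i + 1))).map (x i)).prod

theorem svVec_ne_zero (x : (i : Fin m) → Fin (n i + 1) → ℂ) (hx : ∀ i, x i ≠ 0) :
    svVec n d x ≠ 0 := by
  have h : ∀ i, ∃ j, x i j ≠ 0 := fun i => Function.ne_iff.mp (hx i)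
  choose j hj using h
  refine Function.ne_iff.mpr ⟨fun i => Sym.replicate (d i) (j i), ?_⟩
  simp only [svVec, Pi.zero_apply]
  refine Finset.prod_ne_zero_iff.mpr fun i _ => ?_
  simp [Sym.coe_replicate, hj i]

/-- The Segre–Veronese variety: the image of `ℙ^(n_1) × ⋯ × ℙ^(n_m)` under the map given by all
monomials of multidegree `(d_1, …, d_m)`. -/
def segreVeronese : Set (ProjSpace (SVIndex n d)) :=
  {p | ∃ (x : (i : Fin m) → Fin (n i + 1) → ℂ) (hx : ∀ i, x i ≠ 0),
    p = ProjSpace.mk (svVec n d x) (svVec_ne_zero n d x hx)}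

end SegreVeronese

end

/-! On the standard chart a hyperplane section becomes a polynomial f of multidegree at most d, and
tangency at a chart point forces the gradient of f to vanish there. If the Hessian of f at the base
point is invertible, that point is an isolated critical point
(`exists_isolating_of_jacobian_ne_zero`), so the contact locus is the point alone
(`contactLocus_eq_singleton_of_hessian`).

The Hessian determinant is a form in the coefficients of the hyperplane, so its nonvanishing is an
open condition, and it is enough to exhibit one tangent hyperplane satisfying it. Products of
coordinates from different factors are available for every d, so it suffices to find an invertible
symmetric matrix with zero diagonal blocks of sizes n_i. The inequality on n says that no block
exceeds half the total, and then such a matrix exists (`exists_symmetric_matrix_offDiagonal`): place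
the coordinates around a circle, block by block, and pair each with the ones opposite to it. Since
the variety and its tangent linear systems are irreducible, generic dimension zero excludes generic
positive dimension. -/

open ProjSpace

/-! ### Zariski topology and irreducibility in projective space -/

namespace ProjSpace

variable {ι : Type}

theorem coords_ne_zero (p : ProjSpace ι) : p.coords ≠ 0 := Projectivization.rep_nonzero p

theorem exists_coords_mk (v : ι → ℂ) (hv : v ≠ 0) :
    ∃ c : ℂ, c ≠ 0 ∧ (mk v hv).coords = c • v := by
  obtain ⟨a, ha⟩ := Projectivization.exists_smul_eq_mk_rep ℂ v hv
  exact ⟨a, a.ne_zero, ha.symm⟩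

theorem eq_of_coords_eq_smul {p q : ProjSpace ι} {c : ℂ} (h : p.coords = c • q.coords) :
    p = q := by
  have hc : c ≠ 0 := by
    rintro rfl
    exact p.coords_ne_zero (by simpa using h)
  rw [← Projectivization.mk_rep p, ← Projectivization.mk_rep q]
  exact (Projectivization.mk_eq_mk_iff' ℂ _ _ _ _).2 ⟨c, h.symm⟩

theorem eq_mk_of_coords_eq_smul {p : ProjSpace ι} {v : ι → ℂ} (hv : v ≠ 0) {c : ℂ}
    (h : p.coords = c • v) : p = mk v hv := by
  obtain ⟨c', hc', h'⟩ := exists_coords_mk v hv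
  refine eq_of_coords_eq_smul (c := c * c'⁻¹) ?_
  rw [h', h, smul_smul, inv_mul_cancel_right₀ hc']

theorem eval_smul_of_isHomogeneous {F : MvPolynomial ι ℂ} {k : ℕ} (hF : F.IsHomogeneous k)
    (c : ℂ) (v : ι → ℂ) :
    MvPolynomial.eval (c • v) F = c ^ k * MvPolynomial.eval v F := by
  rw [MvPolynomial.eval_eq, MvPolynomial.eval_eq, Finset.mul_sum]
  refine Finset.sum_congr rfl fun s hs => ?_
  have hk : s.degree = k := by
    rw [← hF (MvPolynomial.mem_support_iff.1 hs), Finsupp.degree_eq_weight_one]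
    rfl
  simp only [Pi.smul_apply, smul_eq_mul, mul_pow, Finset.prod_mul_distrib,
    Finset.prod_pow_eq_pow_sum]
  rw [← hk, Finsupp.degree_apply]
  ring

theorem isOpen_eval_ne_zero {F : MvPolynomial ι ℂ} {k : ℕ} (hF : F.IsHomogeneous k) :
    IsOpen {p : ProjSpace ι | MvPolynomial.eval p.coords F ≠ 0} :=
  TopologicalSpace.isOpen_generateFrom_of_mem ⟨F, k, hF, rfl⟩

/-- A product of forms is a form, so the generating sets really are a basis; topological claims
thereby reduce to forms. -/
theorem exists_eval_ne_zero_of_isOpen {U : Set (ProjSpace ι)} (hU : IsOpen U)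
    {p : ProjSpace ι} (hp : p ∈ U) :
    ∃ (F : MvPolynomial ι ℂ) (k : ℕ), F.IsHomogeneous k ∧ MvPolynomial.eval p.coords F ≠ 0 ∧
      ∀ q : ProjSpace ι, MvPolynomial.eval q.coords F ≠ 0 → q ∈ U := by
  induction hU with
  | basic s hs =>
    obtain ⟨F, k, hF, rfl⟩ := hs
    exact ⟨F, k, hF, hp, fun q hq => hq⟩
  | univ => exact ⟨1, 0, MvPolynomial.isHomogeneous_one _ _, by simp, fun _ _ => trivial⟩
  | inter s t _ _ hs ht =>
    obtain ⟨F, k, hF, hFp, hFs⟩ := hs hp.1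
    obtain ⟨G, l, hG, hGp, hGt⟩ := ht hp.2
    refine ⟨F * G, k + l, hF.mul hG, by simp [hFp, hGp], fun q hq => ?_⟩
    rw [map_mul] at hq
    exact ⟨hFs q (left_ne_zero_of_mul hq), hGt q (right_ne_zero_of_mul hq)⟩
  | sUnion S _ hS =>
    obtain ⟨s, hs, hps⟩ := hp
    obtain ⟨F, k, hF, hFp, hFs⟩ := hS s hs hps
    exact ⟨F, k, hF, hFp, fun q hq => ⟨s, hs, hFs q hq⟩⟩

/-- Distinct points have a nonzero 2×2 minor; with q fixed, that minor is a linear form vanishing at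
q but not at p. -/
instance : T1Space (ProjSpace ι) := by
  refine t1Space_iff_exists_open.2 fun p q hpq => ?_
  obtain ⟨i, hi⟩ := Function.ne_iff.1 q.coords_ne_zero
  have hi' : q.coords i ≠ 0 := hi
  have : ∃ j, p.coords j * q.coords i - q.coords j * p.coords i ≠ 0 := by
    by_contra! h
    refine hpq (eq_of_coords_eq_smul (c := p.coords i / q.coords i) (funext fun j => ?_))
    simp only [Pi.smul_apply, smul_eq_mul]
    field_simp
    linear_combination h j
  obtain ⟨j, hj⟩ := this
  refine ⟨_, isOpen_eval_ne_zero (F := MvPolynomial.X j * MvPolynomial.C (q.coords i) -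
    MvPolynomial.X i * MvPolynomial.C (q.coords j)) (k := 1) ?_, ?_, ?_⟩
  · refine MvPolynomial.IsHomogeneous.sub ?_ ?_
    · simpa using (MvPolynomial.isHomogeneous_X ℂ j).mul
        (MvPolynomial.isHomogeneous_C ι (q.coords i))
    · simpa using (MvPolynomial.isHomogeneous_X ℂ i).mul
        (MvPolynomial.isHomogeneous_C ι (q.coords j))
  · intro h
    apply hj
    simp only [map_sub, map_mul, MvPolynomial.eval_X, MvPolynomial.eval_C] at h
    linear_combination h
  · simp only [Set.mem_ofPred_eq, map_sub, map_mul, MvPolynomial.eval_X, MvPolynomial.eval_C]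
    intro h
    apply h
    ring

/-- A set is irreducible if any two of its points are joined by a polynomial curve, all but
finitely many of whose points lie in the set. -/
theorem isPreirreducible_of_curves {S : Set (ProjSpace ι)}
    (h : ∀ p ∈ S, ∀ q ∈ S, ∃ (γ : ι → Polynomial ℂ) (g : Polynomial ℂ) (a b : ℂ), g ≠ 0 ∧
      a ≠ 0 ∧ b ≠ 0 ∧
      (∀ j, (γ j).eval 0 = a * p.coords j) ∧ (∀ j, (γ j).eval 1 = b * q.coords j) ∧
      ∀ t, g.eval t ≠ 0 → ∃ s ∈ S, ∃ c : ℂ, c ≠ 0 ∧ (fun j => (γ j).eval t) = c • s.coords) :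
    IsPreirreducible S := by
  rintro U V hU hV ⟨p, hpS, hpU⟩ ⟨q, hqS, hqV⟩
  obtain ⟨F, k, hF, hFp, hFU⟩ := exists_eval_ne_zero_of_isOpen hU hpU
  obtain ⟨G, l, hG, hGq, hGV⟩ := exists_eval_ne_zero_of_isOpen hV hqV
  obtain ⟨γ, g, a, b, hg, ha, hb, h0, h1, hγ⟩ := h p hpS q hqS
  have key : ∀ (E : MvPolynomial ι ℂ) (t : ℂ), (MvPolynomial.aeval γ E).eval t =
      MvPolynomial.eval (fun j => (γ j).eval t) E := by
    intro E t
    induction E using MvPolynomial.induction_on with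
    | C a => simp
    | add p q hp hq => simp [hp, hq]
    | mul_X p i hp => simp [hp]
  -- Restricted to the curve, F and G become one-variable polynomials, nonzero because of their
  -- values at 0 and 1; some t avoids the roots of both and of g.
  have hF0 : MvPolynomial.aeval γ F ≠ 0 := by
    intro h
    have h2 := key F 0
    rw [h, show (fun j => (γ j).eval 0) = a • p.coords from funext h0,
      eval_smul_of_isHomogeneous hF, Polynomial.eval_zero] at h2
    exact mul_ne_zero (pow_ne_zero _ ha) hFp h2.symm
  have hG0 : MvPolynomial.aeval γ G ≠ 0 := by
    intro h
    have h2 := key G 1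
    rw [h, show (fun j => (γ j).eval 1) = b • q.coords from funext h1,
      eval_smul_of_isHomogeneous hG, Polynomial.eval_zero] at h2
    exact mul_ne_zero (pow_ne_zero _ hb) hGq h2.symm
  obtain ⟨t, ht⟩ : ∃ t, (MvPolynomial.aeval γ F * MvPolynomial.aeval γ G * g).eval t ≠ 0 := by
    by_contra! h
    exact mul_ne_zero (mul_ne_zero hF0 hG0) hg (Polynomial.funext (by simpa using h))
  simp only [Polynomial.eval_mul, key] at ht
  obtain ⟨s, hs, c, hc, hsc⟩ := hγ t (right_ne_zero_of_mul ht)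
  rw [hsc, eval_smul_of_isHomogeneous hF, eval_smul_of_isHomogeneous hG] at ht
  have ht' := left_ne_zero_of_mul ht
  exact ⟨s, hs, hFU s (right_ne_zero_of_mul (left_ne_zero_of_mul ht')),
    hGV s (right_ne_zero_of_mul (right_ne_zero_of_mul ht'))⟩

end ProjSpace

theorem ForGeneral.exists_and {α : Type} [TopologicalSpace α] {S : Set α} {P Q : α → Prop}
    (hS : IsPreirreducible S) (hP : ForGeneral S P) (hQ : ForGeneral S Q) :
    ∃ a ∈ S, P a ∧ Q a := by
  obtain ⟨U, hU, hSU, hP⟩ := hP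
  obtain ⟨V, hV, hSV, hQ⟩ := hQ
  obtain ⟨a, ha, haU, haV⟩ := hS U V hU hV hSU hSV
  exact ⟨a, ha, hP a ⟨ha, haU⟩, hQ a ⟨ha, haV⟩⟩

/-! ### Tangent hyperplanes and contact loci -/

section Projective

variable {ι : Type} [Fintype ι]

theorem isPreirreducible_tangentHyperplanes (X : Set (ProjSpace ι)) (y : ProjSpace ι) :
    IsPreirreducible (tangentHyperplanes X y) := by
  refine isPreirreducible_of_curves fun p hp q hq => ?_
  obtain ⟨i, hi⟩ := Function.ne_iff.1 p.coords_ne_zero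
  set γ : ι → Polynomial ℂ := fun j =>
    Polynomial.C (p.coords j) + Polynomial.X * Polynomial.C (q.coords j - p.coords j) with hγ
  -- The curve is the pencil through p and q; where its i-th coordinate is nonzero, it does define a
  -- hyperplane.
  refine ⟨γ, γ i, 1, 1, ?_, one_ne_zero, one_ne_zero, by simp [hγ], by simp [hγ], ?_⟩
  · intro h
    apply hi
    have := congrArg (Polynomial.eval 0) h
    simpa [hγ] using this
  · intro t ht
    have hv : (fun j => (γ j).eval t) ≠ 0 := fun h => ht (congrFun h i)
    obtain ⟨c, hc, hcv⟩ := exists_coords_mk _ hv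
    refine ⟨mk _ hv, ?_, c⁻¹, inv_ne_zero hc, by rw [hcv, inv_smul_smul₀ hc]⟩
    intro w hw
    have h1 : ∑ j, p.coords j * w j = 0 := hp hw
    have h2 : ∑ j, q.coords j * w j = 0 := hq hw
    change ∑ j, (mk _ hv).coords j * w j = 0
    rw [hcv]
    calc ∑ j, (c • fun j => (γ j).eval t) j * w j
        = c * ((1 - t) * ∑ j, p.coords j * w j + t * ∑ j, q.coords j * w j) := by
          simp only [Finset.mul_sum, ← Finset.sum_add_distrib]
          refine Finset.sum_congr rfl fun j _ => ?_
          simp [hγ]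
          ring
      _ = 0 := by rw [h1, h2]; ring

/-- If `x` is an isolated point of the tangency locus, the contact locus is `{x}`. -/
theorem contactLocus_eq_singleton {X : Set (ProjSpace ι)} {x H : ProjSpace ι}
    {V : Set (ProjSpace ι)} (hV : IsOpen V) (hx : x ∈ tangencyLocus X H) (hxV : x ∈ V)
    (h : ∀ y ∈ tangencyLocus X H, y ∈ V → y = x) : contactLocus X x H = {x} := by
  have key : ∀ Y, IsIrreducible Y → Y ⊆ tangencyLocus X H → x ∈ Y → Y ⊆ {x} := by
    intro Y hY hYX hxY y hy
    by_contra hyx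
    -- By irreducibility of Y, the open sets V and the complement of x meet inside Y.
    obtain ⟨z, hzY, hzV, hzx⟩ := hY.2 V {x}ᶜ hV isClosed_singleton.isOpen_compl
      ⟨x, hxY, hxV⟩ ⟨y, hy, hyx⟩
    exact hzx (h z (hYX hzY) hzV)
  refine Set.Subset.antisymm ?_ ?_
  · rintro y ⟨Y, ⟨hY, hxY⟩, hyY⟩
    exact key Y hY.prop.1 hY.prop.2 hxY hyY
  · rintro _ rfl
    exact ⟨{_}, ⟨⟨⟨isIrreducible_singleton, Set.singleton_subset_iff.2 hx⟩,
      fun Y hY hle => key Y hY.1 hY.2 (hle rfl)⟩, rfl⟩, rfl⟩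

theorem topologicalKrullDim_singleton {α : Type} [TopologicalSpace α] (x : α) :
    topologicalKrullDim ({x} : Set α) = 0 := by
  refine le_antisymm (topologicalKrullDim_zero_of_discreteTopology _) ?_
  have : Nonempty (TopologicalSpace.IrreducibleCloseds ({x} : Set α)) :=
    ⟨⟨closure {⟨x, rfl⟩}, isIrreducible_singleton.closure, isClosed_closure⟩⟩
  exact Order.krullDim_nonneg

end Projective

/-! ### An invertible symmetric matrix with zero diagonal blocks -/

/-- The symmetric circulant matrix pairing each residue with the opposite ones is invertible. -/
theorem eq_zero_of_add_opposite_eq_zero (N : ℕ) (f : ZMod N → ℂ)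
    (hf : ∀ v, f (v + (N / 2 : ℕ)) + f (v - (N / 2 : ℕ)) = 0) : f = 0 := by
  have step : ∀ v, f (v + 2 * (N / 2 : ℕ)) = - f v := by
    intro v
    have := hf (v + (N / 2 : ℕ))
    rw [add_sub_cancel_right, add_assoc, ← two_mul] at this
    exact eq_neg_of_add_eq_zero_left this
  have iter : ∀ (k : ℕ) v, f (v + k * (2 * (N / 2 : ℕ))) = (-1) ^ k * f v := by
    intro k
    induction k with
    | zero => simp
    | succ k ih =>
      intro v
      rw [Nat.cast_succ, add_mul, one_mul, ← add_assoc, step, ih, pow_succ]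
      ring
  funext v
  have h : f v = - f v := by
    -- For N even the shift by 2(N/2) is trivial. For N odd, N such shifts return to v after an odd
    -- number of sign changes.
    rcases Nat.even_or_odd N with hN | hN
    · have h2 := step v
      rwa [show (2 * (N / 2 : ℕ) : ZMod N) = 0 by
        rw [← Nat.cast_two, ← Nat.cast_mul, Nat.two_mul_div_two_of_even hN, ZMod.natCast_self],
        add_zero] at h2
    · simpa [hN.neg_one_pow] using iter N v
  simpa using self_eq_neg.1 h

theorem exists_symmetric_matrix_offDiagonal {m : ℕ} (n : Fin m → ℕ)
    (hn : ∀ i, 2 * n i ≤ ∑ j, n j) :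
    ∃ S : Matrix ((i : Fin m) × Fin (n i)) ((i : Fin m) × Fin (n i)) ℂ,
      S.IsSymm ∧ S.det ≠ 0 ∧ ∀ u v, u.1 = v.1 → S u v = 0 := by
  obtain ⟨N, hN⟩ : ∃ N, N = ∑ j, n j := ⟨_, rfl⟩
  rcases Nat.eq_zero_or_pos N with h0 | hpos
  · have : IsEmpty ((i : Fin m) × Fin (n i)) := ⟨fun u => by
      have h1 := hn u.1
      have h2 := u.2.2
      omega⟩
    exact ⟨0, by simp [Matrix.IsSymm], by simp, fun _ _ _ => rfl⟩
  have : NeZero N := ⟨hpos.ne'⟩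
  -- Each block becomes an interval of consecutive residues.
  let e : ((i : Fin m) × Fin (n i)) ≃ ZMod N :=
    (finSigmaFinEquiv.trans (finCongr hN.symm)).trans (ZMod.finEquiv N).toEquiv
  have he : ∀ u, ∃ a : ℕ, e u = a ∧ a = (finSigmaFinEquiv u : ℕ) := fun u =>
    ⟨_, by
      change (ZMod.finEquiv N) _ = _
      obtain _ | N := N
      · omega
      · exact (Fin.cast_val_eq_self _).symm, rfl⟩
  have hne : ∀ u v, u.1 = v.1 → e v ≠ e u + (N / 2 : ℕ) := by
    rintro ⟨i, u⟩ ⟨_, v⟩ rfl h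
    obtain ⟨a, ha, ha'⟩ := he ⟨i, u⟩
    obtain ⟨b, hb, hb'⟩ := he ⟨i, v⟩
    rw [finSigmaFinEquiv_apply] at ha' hb'
    simp only at ha' hb'
    have hu := u.2
    have hv := v.2
    have hi := hn i
    rw [ha, hb, ← Nat.cast_add, ZMod.natCast_eq_natCast_iff] at h
    -- Positions in one block differ by less than n i ≤ N/2, so a + N/2 - b lies strictly between 0
    -- and N and cannot be divisible by N.
    have hd := (Nat.modEq_iff_dvd' (by omega)).1 h
    have := Nat.le_of_dvd (by omega) hd
    omega
  refine ⟨Matrix.of fun u v => (if e v = e u + (N / 2 : ℕ) then 1 else 0) +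
      (if e v = e u - (N / 2 : ℕ) then 1 else 0), ?_, ?_, ?_⟩
  · ext u v
    simp only [Matrix.transpose_apply, Matrix.of_apply]
    rw [add_comm]
    congr 2
    · exact propext ⟨fun h => by rw [h]; ring, fun h => by rw [h]; ring⟩
    · exact propext ⟨fun h => by rw [h]; ring, fun h => by rw [h]; ring⟩
  · intro hdet
    obtain ⟨f, hf0, hf⟩ := Matrix.exists_mulVec_eq_zero_iff.2 hdet
    apply hf0
    have h0 := eq_zero_of_add_opposite_eq_zero N (f ∘ e.symm) fun v => by
      have := congrFun hf (e.symm v)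
      simp only [Matrix.mulVec, dotProduct, Matrix.of_apply, add_mul, Finset.sum_add_distrib,
        ite_mul, one_mul, zero_mul, Equiv.apply_symm_apply, ← Equiv.eq_symm_apply,
        Finset.sum_ite_eq', Finset.mem_univ, if_true, Pi.zero_apply] at this
      exact this
    funext u
    simpa using congrFun h0 (e u)
  · intro u v huv
    have h2 := hne v u huv.symm
    simp only [Matrix.of_apply]
    rw [if_neg (hne u v huv), if_neg (fun h => h2 (by rw [h]; ring)), add_zero]

/-! ### Isolated zeros and the chain rule for polynomials -/

namespace MvPolynomial

variable {σ : Type} [Fintype σ]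

theorem exists_eq_sum_mul_X_sub_C (a : σ → ℂ) (p : MvPolynomial σ ℂ) :
    ∃ M : σ → MvPolynomial σ ℂ, p = C (eval a p) + ∑ i, M i * (X i - C (a i)) := by
  classical
  induction p using MvPolynomial.induction_on with
  | C c => exact ⟨0, by simp⟩
  | add p q hp hq =>
    obtain ⟨M, hM⟩ := hp
    obtain ⟨M', hM'⟩ := hq
    refine ⟨M + M', ?_⟩
    simp only [map_add, Pi.add_apply, add_mul, Finset.sum_add_distrib]
    linear_combination hM + hM'
  | mul_X p i hp =>
    obtain ⟨M, hM⟩ := hp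
    refine ⟨fun j => M j * X i + Pi.single (M := fun _ => MvPolynomial σ ℂ) i (C (eval a p)) j, ?_⟩
    simp only [map_mul, eval_X, add_mul, Finset.sum_add_distrib, Pi.single_apply, ite_mul,
      zero_mul, Finset.sum_ite_eq', Finset.mem_univ, if_true, mul_right_comm _ (X i),
      ← Finset.sum_mul]
    linear_combination hM * X i

/-- An isolated zero: if `a` is a zero of the square system `f` with nonvanishing Jacobian, then
it is the only zero outside some hypersurface not containing `a`. -/
theorem exists_isolating_of_jacobian_ne_zero [DecidableEq σ] (a : σ → ℂ)
    (f : σ → MvPolynomial σ ℂ) (hf : ∀ i, eval a (f i) = 0)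
    (hJ : (Matrix.of fun i j => eval a (pderiv j (f i))).det ≠ 0) :
    ∃ g : MvPolynomial σ ℂ, eval a g ≠ 0 ∧
      ∀ b, (∀ i, eval b (f i) = 0) → eval b g ≠ 0 → b = a := by
  choose M hM using fun i => exists_eq_sum_mul_X_sub_C a (f i)
  simp only [hf, map_zero, zero_add] at hM
  -- M specializes at a to the Jacobian, and M(b)(b - a) = 0 at any common zero b.
  refine ⟨(Matrix.of M).det, ?_, fun b hb hg => ?_⟩
  · rw [RingHom.map_det]
    convert hJ using 2
    ext i j
    simp only [RingHom.mapMatrix_apply, Matrix.map_apply, Matrix.of_apply]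
    conv_rhs => rw [hM i]
    simp [pderiv_X, Pi.single_apply, apply_ite (eval a)]
  · rw [RingHom.map_det] at hg
    have h0 : ((eval b).mapMatrix (Matrix.of M)).mulVec (b - a) = 0 := by
      funext i
      have := hb i
      rw [hM i] at this
      simpa [Matrix.mulVec, dotProduct] using this
    exact sub_eq_zero.1 (Matrix.eq_zero_of_mulVec_eq_zero hg h0)

theorem pderiv_aeval_eq_sum {ι τ : Type} [Fintype ι] (φ : ι → MvPolynomial τ ℂ) (b : τ)
    (F : MvPolynomial ι ℂ) :
    pderiv b (aeval φ F) = ∑ j, aeval φ (pderiv j F) * pderiv b (φ j) := by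
  classical
  induction F using MvPolynomial.induction_on with
  | C c => simp [algebraMap_eq]
  | add p q hp hq => simp only [map_add, hp, hq, add_mul, Finset.sum_add_distrib]
  | mul_X p i hp =>
    simp only [map_mul, aeval_X, Derivation.leibniz, smul_eq_mul, hp, pderiv_X, map_add, add_mul,
      Finset.sum_add_distrib, Pi.single_apply, apply_ite (aeval φ), map_zero, mul_ite,
      mul_one, mul_zero, ite_mul, zero_mul, Finset.sum_ite_eq, Finset.mem_univ, if_true,
      Finset.mul_sum]
    simp [mul_assoc]

end MvPolynomial

/-! ### The standard chart of the Segre–Veronese variety -/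

section SegreVeronese

open MvPolynomial

variable {m : ℕ} {n d : Fin m → ℕ}

/-- Affine coordinates on the standard chart of `ℙ^(n_1) × ⋯ × ℙ^(n_m)`. -/
abbrev SVChart (n : Fin m → ℕ) : Type := (i : Fin m) × Fin (n i)

/-- Homogeneous coordinates of a point of the standard chart. -/
def chartPoint {R : Type} [CommRing R] (b : SVChart n → R) : (i : Fin m) → Fin (n i + 1) → R :=
  fun i => Fin.cons 1 fun j => b ⟨i, j⟩

/-- A monomial of multidegree `d`, dehomogenized in the standard chart. -/
noncomputable def svMonomial (J : SVIndex n d) : MvPolynomial (SVChart n) ℂ :=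
  ∏ i, ((J i : Multiset (Fin (n i + 1))).map (chartPoint X i)).prod

/-- The Segre–Veronese vector of a point of the standard chart. -/
def chartVec (d : Fin m → ℕ) (b : SVChart n → ℂ) : SVIndex n d → ℂ := svVec n d (chartPoint b)

/-- The index of the monomial that is `1` in the standard chart. -/
def baseIndex (n d : Fin m → ℕ) : SVIndex n d := fun i => Sym.replicate (d i) 0

theorem eval_svMonomial (b : SVChart n → ℂ) (J : SVIndex n d) :
    eval b (svMonomial J) = chartVec d b J := by
  simp only [svMonomial, chartVec, svVec, map_prod, map_multiset_prod, Multiset.map_map]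
  refine Finset.prod_congr rfl fun i _ => congrArg Multiset.prod (Multiset.map_congr rfl ?_)
  intro j _
  refine Fin.cases ?_ (fun k => ?_) j <;> simp [chartPoint]

theorem svMonomial_baseIndex : svMonomial (baseIndex n d) = 1 := by
  simp [svMonomial, baseIndex, Sym.coe_replicate, chartPoint]

theorem chartVec_baseIndex (b : SVChart n → ℂ) : chartVec d b (baseIndex n d) = 1 := by
  rw [← eval_svMonomial, svMonomial_baseIndex, map_one]

theorem chartPoint_ne_zero (b : SVChart n → ℂ) (i : Fin m) : chartPoint b i ≠ 0 :=
  Function.ne_iff.2 ⟨0, by simp [chartPoint]⟩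

theorem chartVec_ne_zero (b : SVChart n → ℂ) : chartVec d b ≠ 0 :=
  svVec_ne_zero n d _ (chartPoint_ne_zero b)

theorem svVec_smul (c : Fin m → ℂ) (z : (i : Fin m) → Fin (n i + 1) → ℂ) :
    svVec n d (fun i => c i • z i) = (∏ i, c i ^ d i) • svVec n d z := by
  funext J
  simp only [svVec, Pi.smul_apply, smul_eq_mul, ← Finset.prod_mul_distrib]
  refine Finset.prod_congr rfl fun i _ => ?_
  rw [Multiset.prod_map_mul, Multiset.map_const', Multiset.prod_replicate, Sym.card_coe]

theorem svVec_baseIndex (z : (i : Fin m) → Fin (n i + 1) → ℂ) :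
    svVec n d z (baseIndex n d) = ∏ i, z i 0 ^ d i := by
  simp [svVec, baseIndex, Sym.coe_replicate]

/-- Points of the Segre–Veronese variety in the standard chart. -/
theorem exists_coords_eq_smul_chartVec (hd : ∀ i, 1 ≤ d i) {p : ProjSpace (SVIndex n d)}
    (hp : p ∈ segreVeronese n d) (h0 : p.coords (baseIndex n d) ≠ 0) :
    ∃ (c : ℂ) (b : SVChart n → ℂ), c ≠ 0 ∧ p.coords = c • chartVec d b := by
  obtain ⟨z, hz, rfl⟩ := hp
  obtain ⟨c, hc, hcz⟩ := exists_coords_mk _ (svVec_ne_zero n d z hz)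
  rw [hcz, Pi.smul_apply, svVec_baseIndex, smul_eq_mul] at h0
  -- Positivity of d i lets the base monomial detect the vanishing of z i 0.
  have hz0 : ∀ i, z i 0 ≠ 0 := fun i hi =>
    right_ne_zero_of_mul h0 (Finset.prod_eq_zero (Finset.mem_univ i)
      (by rw [hi, zero_pow (by have := hd i; omega)]))
  refine ⟨c * ∏ i, z i 0 ^ d i, fun u => z u.1 u.2.succ / z u.1 0, h0, ?_⟩
  rw [hcz, mul_smul, chartVec, ← svVec_smul]
  congr 2
  funext i j
  refine Fin.cases ?_ (fun k => ?_) j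
  · simp [chartPoint]
  · simp [chartPoint, mul_div_cancel₀ _ (hz0 i)]

/-- The point of the Segre–Veronese variety with given affine coordinates. -/
theorem mk_chartVec_mem (b : SVChart n → ℂ) :
    ProjSpace.mk (chartVec d b) (chartVec_ne_zero b) ∈ segreVeronese n d :=
  ⟨chartPoint b, chartPoint_ne_zero b, rfl⟩

theorem eval_svVec_eq_zero {F : MvPolynomial (SVIndex n d) ℂ} {k : ℕ} (hF : F.IsHomogeneous k)
    (hX : ∀ q ∈ segreVeronese n d, eval q.coords F = 0)
    (z : (i : Fin m) → Fin (n i + 1) → ℂ) (hz : ∀ i, z i ≠ 0) : eval (svVec n d z) F = 0 := by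
  have h := hX _ ⟨z, hz, rfl⟩
  obtain ⟨c, hc, hcz⟩ := exists_coords_mk _ (svVec_ne_zero n d z hz)
  rw [hcz, eval_smul_of_isHomogeneous hF] at h
  exact (mul_eq_zero.1 h).resolve_left (pow_ne_zero _ hc)

theorem isPreirreducible_segreVeronese : IsPreirreducible (segreVeronese n d) := by
  refine isPreirreducible_of_curves ?_
  rintro _ ⟨x, hx, rfl⟩ _ ⟨y, hy, rfl⟩
  have hxi : ∀ i, ∃ j, x i j ≠ 0 := fun i => Function.ne_iff.1 (hx i)
  choose j hj using hxi
  obtain ⟨c, hc, hcx⟩ := exists_coords_mk _ (svVec_ne_zero n d x hx)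
  obtain ⟨e, he, hey⟩ := exists_coords_mk _ (svVec_ne_zero n d y hy)
  set ℓ : (i : Fin m) → Fin (n i + 1) → Polynomial ℂ := fun i j =>
    Polynomial.C (x i j) + Polynomial.X * Polynomial.C (y i j - x i j) with hℓ
  have heval : ∀ (J : SVIndex n d) t, (∏ i, ((J i : Multiset (Fin (n i + 1))).map (ℓ i)).prod).eval t
      = svVec n d (fun i j => (ℓ i j).eval t) J := by
    intro J t
    simp only [svVec, Polynomial.eval_prod, Polynomial.eval_multiset_prod, Multiset.map_map,
      Function.comp_def]
  -- The curve is the image of lines joining x and y in each factor; the product of the ℓ i (j i)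
  -- keeps every factor away from the zero vector.
  refine ⟨fun J => ∏ i, ((J i : Multiset (Fin (n i + 1))).map (ℓ i)).prod, ∏ i, ℓ i (j i),
    c⁻¹, e⁻¹, ?_, inv_ne_zero hc, inv_ne_zero he, ?_, ?_, ?_⟩
  · refine Finset.prod_ne_zero_iff.2 fun i _ h => hj i ?_
    simpa [hℓ] using congrArg (Polynomial.eval 0) h
  · intro J
    rw [heval, hcx]
    simp [hℓ, hc]
  · intro J
    rw [heval, hey]
    simp [hℓ, he]
  · intro t ht
    rw [Polynomial.eval_prod, Finset.prod_ne_zero_iff] at ht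
    have hz : ∀ i, (fun j => (ℓ i j).eval t) ≠ 0 := fun i h =>
      ht i (Finset.mem_univ i) (congrFun h (j i))
    obtain ⟨a, ha, haz⟩ := exists_coords_mk _ (svVec_ne_zero n d _ hz)
    refine ⟨_, ⟨_, hz, rfl⟩, a⁻¹, inv_ne_zero ha, ?_⟩
    rw [haz, inv_smul_smul₀ ha]
    exact funext fun J => heval J t

/-! ### Embedded tangent spaces -/

/-- The partial derivatives of the parametrization are tangent vectors. -/
theorem pderiv_mem_embeddedTangentSpace {y : ProjSpace (SVIndex n d)} {c : ℂ}
    {b : SVChart n → ℂ} (hy : y.coords = c • chartVec d b) (β : SVChart n) :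
    (fun J => eval b (pderiv β (svMonomial J))) ∈ embeddedTangentSpace (segreVeronese n d) y := by
  intro F k hF hX
  have h0 : aeval (svMonomial (n := n) (d := d)) F = 0 := by
    refine MvPolynomial.funext fun a => ?_
    rw [map_zero, ← eval_svVec_eq_zero hF hX (chartPoint a) (chartPoint_ne_zero a)]
    change eval a (aeval _ F) = eval (chartVec d a) F
    rw [← funext (eval_svMonomial a), ← aeval_eq_eval, ← aeval_eq_eval, ← comp_aeval_apply]
  have h1 := congrArg (eval b) (pderiv_aeval_eq_sum (svMonomial (n := n) (d := d)) β F)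
  rw [h0, map_zero, map_zero, map_sum] at h1
  have h2 : ∀ G : MvPolynomial (SVIndex n d) ℂ,
      eval b (aeval (svMonomial (n := n) (d := d)) G) = eval (chartVec d b) G := by
    intro G
    rw [← funext (eval_svMonomial b), ← aeval_eq_eval, ← aeval_eq_eval, ← comp_aeval_apply]
  simp only [map_mul, h2] at h1
  simp only [hy, eval_smul_of_isHomogeneous hF.pderiv, mul_assoc, ← Finset.mul_sum]
  rw [← h1, mul_zero]

/-- The multiset `{j, 0, …, 0}` of size `d_i`. -/
def unitSym (hd : ∀ i, 1 ≤ d i) (u : SVChart n) : Sym (Fin (n u.1 + 1)) (d u.1) :=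
  ⟨u.2.succ ::ₘ Multiset.replicate (d u.1 - 1) 0, by
    rw [Multiset.card_cons, Multiset.card_replicate, Nat.sub_add_cancel (hd u.1)]⟩

/-- The index of the monomial that is an affine coordinate in the standard chart. -/
def unitIndex (hd : ∀ i, 1 ≤ d i) (u : SVChart n) : SVIndex n d :=
  Function.update (baseIndex n d) u.1 (unitSym hd u)

/-- The multiset obtained by replacing one element `j ≠ 0` by `0`. -/
def lowerSym (J : SVIndex n d) (u : SVChart n) (hu : u.2.succ ∈ J u.1) :
    Sym (Fin (n u.1 + 1)) (d u.1) :=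
  ⟨0 ::ₘ (J u.1 : Multiset (Fin (n u.1 + 1))).erase u.2.succ, by
    rw [Multiset.card_cons, Multiset.card_erase_add_one (Sym.mem_coe.2 hu), Sym.card_coe]⟩

/-- The index of the monomial obtained by replacing one factor `x_j`, `j ≠ 0`, by `x_0`. -/
def lowerIndex (J : SVIndex n d) (u : SVChart n) (hu : u.2.succ ∈ J u.1) : SVIndex n d :=
  Function.update J u.1 (lowerSym J u hu)

theorem unitIndex_self (hd : ∀ i, 1 ≤ d i) (u : SVChart n) : unitIndex hd u u.1 = unitSym hd u :=
  Function.update_self ..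

theorem coe_lowerIndex_self (J : SVIndex n d) (u : SVChart n) (hu : u.2.succ ∈ J u.1) :
    (lowerIndex J u hu u.1 : Multiset (Fin (n u.1 + 1))) =
      0 ::ₘ (J u.1 : Multiset (Fin (n u.1 + 1))).erase u.2.succ := by
  rw [lowerIndex, Function.update_self]
  rfl

/-- Exchanging one x_j of J for an x_0 of the base monomial gives a quadric through the variety. A
general ring R serves both points and polynomial monomials. -/
theorem prod_map_mul_prod_map_baseIndex {R : Type} [CommRing R] (hd : ∀ i, 1 ≤ d i)
    (z : (i : Fin m) → Fin (n i + 1) → R)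
    (J : SVIndex n d) (u : SVChart n) (hu : u.2.succ ∈ J u.1) :
    (∏ i, ((J i : Multiset (Fin (n i + 1))).map (z i)).prod) *
        ∏ i, ((baseIndex n d i : Multiset (Fin (n i + 1))).map (z i)).prod =
      (∏ i, ((unitIndex hd u i : Multiset (Fin (n i + 1))).map (z i)).prod) *
        ∏ i, ((lowerIndex J u hu i : Multiset (Fin (n i + 1))).map (z i)).prod := by
  rw [← Finset.prod_mul_distrib, ← Finset.prod_mul_distrib]
  refine Finset.prod_congr rfl fun i _ => ?_
  by_cases hi : i = u.1
  · subst hi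
    simp only [unitIndex_self, coe_lowerIndex_self, unitSym, baseIndex, Sym.coe_replicate,
      Sym.coe_mk, Multiset.map_cons, Multiset.prod_cons, Multiset.map_replicate,
      Multiset.prod_replicate]
    conv_lhs => rw [← Multiset.cons_erase (s := (J u.1 : Multiset (Fin (n u.1 + 1)))) hu]
    rw [Multiset.map_cons, Multiset.prod_cons, ← mul_pow_sub_one (Nat.one_le_iff_ne_zero.1 (hd u.1))]
    ring
  · rw [unitIndex, lowerIndex, Function.update_of_ne hi, Function.update_of_ne hi, mul_comm]

theorem svMonomial_update {J : SVIndex n d} {i : Fin m} (hJ : J i = Sym.replicate (d i) 0)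
    (s : Sym (Fin (n i + 1)) (d i)) :
    svMonomial (Function.update J i s) =
      svMonomial J * ((s : Multiset (Fin (n i + 1))).map (chartPoint X i)).prod := by
  rw [svMonomial, svMonomial, ← Finset.mul_prod_erase _ _ (Finset.mem_univ i),
    ← Finset.mul_prod_erase _ _ (Finset.mem_univ i), Function.update_self, hJ, mul_comm]
  congr 1
  simp only [Sym.coe_replicate, Multiset.map_replicate, Multiset.prod_replicate, chartPoint,
    Fin.cons_zero, one_pow, one_mul]
  refine Finset.prod_congr rfl fun j hj => ?_
  rw [Function.update_of_ne (Finset.ne_of_mem_erase hj)]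

theorem prod_map_unitSym (hd : ∀ i, 1 ≤ d i) (u : SVChart n) :
    ((unitSym hd u : Multiset (Fin (n u.1 + 1))).map
      (chartPoint (X : SVChart n → MvPolynomial (SVChart n) ℂ) u.1)).prod = X u := by
  simp [unitSym, chartPoint]

theorem svMonomial_unitIndex (hd : ∀ i, 1 ≤ d i) (u : SVChart n) :
    svMonomial (unitIndex hd u) = X u := by
  rw [unitIndex, svMonomial_update rfl, prod_map_unitSym, svMonomial_baseIndex, one_mul]

theorem svMonomial_eq_X_mul (hd : ∀ i, 1 ≤ d i) (J : SVIndex n d) (u : SVChart n)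
    (hu : u.2.succ ∈ J u.1) : svMonomial J = X u * svMonomial (lowerIndex J u hu) := by
  have h := prod_map_mul_prod_map_baseIndex hd
    (chartPoint (X : SVChart n → MvPolynomial (SVChart n) ℂ)) J u hu
  change svMonomial J * svMonomial (baseIndex n d) =
    svMonomial (unitIndex hd u) * svMonomial (lowerIndex J u hu) at h
  rwa [svMonomial_baseIndex, mul_one, svMonomial_unitIndex] at h

/-- Lowering decreases the number of nonzero indices, and only the base index has none. -/
theorem induction_on_lowerIndex {P : SVIndex n d → Prop} (hbase : P (baseIndex n d))
    (hlower : ∀ J u hu, P (lowerIndex J u hu) → P J) (J : SVIndex n d) : P J := by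
  obtain ⟨k, hk⟩ : ∃ k, k = ∑ i, (J i : Multiset (Fin (n i + 1))).countP (· ≠ 0) := ⟨_, rfl⟩
  induction k using Nat.strong_induction_on generalizing J with
  | _ k ih =>
    by_cases h : ∃ u : SVChart n, u.2.succ ∈ J u.1
    · obtain ⟨u, hu⟩ := h
      refine hlower J u hu (ih _ ?_ _ rfl)
      rw [hk]
      have hlt : (lowerIndex J u hu u.1 : Multiset (Fin (n u.1 + 1))).countP (· ≠ 0) <
          (J u.1 : Multiset (Fin (n u.1 + 1))).countP (· ≠ 0) := by
        conv_rhs => rw [← Multiset.cons_erase (s := (J u.1 : Multiset (Fin (n u.1 + 1)))) hu]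
        simp [coe_lowerIndex_self]
      refine Finset.sum_lt_sum (fun i _ => ?_) ⟨u.1, Finset.mem_univ _, hlt⟩
      by_cases hi : i = u.1
      · subst hi
        exact hlt.le
      · rw [lowerIndex, Function.update_of_ne hi]
    · have : J = baseIndex n d := by
        funext i
        refine Sym.eq_replicate_iff.2 fun b hb => ?_
        by_contra hb0
        obtain ⟨j, rfl⟩ := Fin.exists_succ_eq.2 hb0
        exact h ⟨⟨i, j⟩, hb⟩
      rwa [this]

/-- The embedded tangent space is spanned by the parametrization and its partial derivatives. -/
theorem apply_eq_of_mem_embeddedTangentSpace (hd : ∀ i, 1 ≤ d i) {y : ProjSpace (SVIndex n d)}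
    {c : ℂ} {b : SVChart n → ℂ} (hc : c ≠ 0) (hy : y.coords = c • chartVec d b)
    {w : SVIndex n d → ℂ} (hw : w ∈ embeddedTangentSpace (segreVeronese n d) y)
    (J : SVIndex n d) :
    w J = w (baseIndex n d) * eval b (svMonomial J) +
      ∑ β, (w (unitIndex hd β) - b β * w (baseIndex n d)) * eval b (pderiv β (svMonomial J)) := by
  classical
  induction J using induction_on_lowerIndex with
  | hbase => simp [svMonomial_baseIndex]
  | hlower J u hu ih =>
    have h := hw (X J * X (baseIndex n d) - X (unitIndex hd u) * X (lowerIndex J u hu)) 2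
      (((isHomogeneous_X _ _).mul (isHomogeneous_X _ _)).sub
        ((isHomogeneous_X _ _).mul (isHomogeneous_X _ _))) (by
          rintro _ ⟨z, hz, rfl⟩
          obtain ⟨e, he, hez⟩ := exists_coords_mk _ (svVec_ne_zero n d z hz)
          have := prod_map_mul_prod_map_baseIndex hd z J u hu
          simp only [map_sub, map_mul, eval_X, hez, Pi.smul_apply, smul_eq_mul, svVec]
          linear_combination e ^ 2 * this)
    simp only [map_sub, Derivation.leibniz, smul_eq_mul, pderiv_X, Pi.single_apply, map_add,
      eval_X, apply_ite (eval y.coords), map_zero, mul_ite, mul_one, mul_zero,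
      sub_mul, add_mul, ite_mul, zero_mul, Finset.sum_sub_distrib, Finset.sum_add_distrib,
      Finset.sum_ite_eq, Finset.mem_univ, if_true] at h
    simp only [hy, Pi.smul_apply, smul_eq_mul, ← eval_svMonomial] at h
    rw [svMonomial_baseIndex, svMonomial_unitIndex, svMonomial_eq_X_mul hd J u hu, map_mul, eval_X,
      map_one] at h
    -- The differential of the exchange quadric determines w J recursively; the product rule gives
    -- the same recursion for the right-hand side.
    have h' := mul_left_cancel₀ hc (b := w J) (c := b u * w (lowerIndex J u hu) +
      eval b (svMonomial (lowerIndex J u hu)) * w (unitIndex hd u) -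
      b u * eval b (svMonomial (lowerIndex J u hu)) * w (baseIndex n d))
      (by linear_combination h)
    rw [h', svMonomial_eq_X_mul hd J u hu]
    simp only [Derivation.leibniz, smul_eq_mul, pderiv_X, Pi.single_apply, map_add,
      map_mul, eval_X, apply_ite (eval b), map_zero, mul_ite, mul_one, mul_zero,
      mul_add, Finset.sum_add_distrib, Finset.sum_ite_eq, Finset.mem_univ,
      if_true, mul_left_comm _ (b u), ← Finset.mul_sum]
    rw [ih]
    ring

/-! ### Hyperplane sections in the chart -/

/-- The multihomogeneous form defining a hyperplane section, in the standard chart. -/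
noncomputable def affineForm (h : SVIndex n d → ℂ) : MvPolynomial (SVChart n) ℂ :=
  ∑ J, C (h J) * svMonomial J

theorem eval_affineForm (h : SVIndex n d → ℂ) (b : SVChart n → ℂ) :
    eval b (affineForm h) = ∑ J, h J * eval b (svMonomial J) := by
  simp [affineForm]

theorem pderiv_affineForm (h : SVIndex n d → ℂ) (β : SVChart n) :
    pderiv β (affineForm h) = ∑ J, C (h J) * pderiv β (svMonomial J) := by
  simp [affineForm]

theorem affineForm_smul (c : ℂ) (h : SVIndex n d → ℂ) :
    affineForm (c • h) = C c * affineForm h := by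
  simp [affineForm, Finset.mul_sum, mul_assoc]

theorem mem_tangentHyperplanes_of_affineForm (hd : ∀ i, 1 ≤ d i) {y H : ProjSpace (SVIndex n d)}
    {c : ℂ} {b : SVChart n → ℂ} (hc : c ≠ 0) (hy : y.coords = c • chartVec d b)
    (h0 : eval b (affineForm H.coords) = 0)
    (h1 : ∀ β, eval b (pderiv β (affineForm H.coords)) = 0) :
    H ∈ tangentHyperplanes (segreVeronese n d) y := by
  intro w hw
  change ∑ J, H.coords J * w J = 0
  simp only [pderiv_affineForm, map_sum, map_mul, eval_C] at h1
  rw [eval_affineForm] at h0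
  calc ∑ J, H.coords J * w J
      = w (baseIndex n d) * ∑ J, H.coords J * eval b (svMonomial J) +
        ∑ β, (w (unitIndex hd β) - b β * w (baseIndex n d)) *
          ∑ J, H.coords J * eval b (pderiv β (svMonomial J)) := by
        simp only [Finset.mul_sum]
        rw [Finset.sum_comm, ← Finset.sum_add_distrib]
        refine Finset.sum_congr rfl fun J _ => ?_
        rw [apply_eq_of_mem_embeddedTangentSpace hd hc hy hw J, mul_add, Finset.mul_sum]
        simp only [mul_left_comm]
    _ = 0 := by simp [h0, h1]

theorem eval_pderiv_affineForm_of_mem {y H : ProjSpace (SVIndex n d)} {c : ℂ}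
    {b : SVChart n → ℂ} (hy : y.coords = c • chartVec d b)
    (hH : H ∈ tangentHyperplanes (segreVeronese n d) y) (β : SVChart n) :
    eval b (pderiv β (affineForm H.coords)) = 0 := by
  have h : ∑ J, H.coords J * eval b (pderiv β (svMonomial J)) = 0 :=
    hH (pderiv_mem_embeddedTangentSpace hy β)
  simpa [pderiv_affineForm] using h

/-- Only 1, X_u and X_u X_v with u, v in different factors occur after expansion, and these are
monomials of the system as soon as every d i ≥ 1. -/
theorem exists_affineForm_eq_quadratic (hd : ∀ i, 1 ≤ d i) (b : SVChart n → ℂ)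
    (S : Matrix (SVChart n) (SVChart n) ℂ) (hS : ∀ u v, u.1 = v.1 → S u v = 0) :
    ∃ h : SVIndex n d → ℂ,
      affineForm h = ∑ u, ∑ v, C (S u v) * ((X u - C (b u)) * (X v - C (b v))) := by
  have hmem : ∀ J : SVIndex n d, svMonomial J ∈
      Submodule.span ℂ (Set.range (svMonomial (n := n) (d := d))) :=
    fun J => Submodule.subset_span ⟨J, rfl⟩
  have hsum : ∑ u, ∑ v, C (S u v) * ((X u - C (b u)) * (X v - C (b v))) ∈
      Submodule.span ℂ (Set.range (svMonomial (n := n) (d := d))) := by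
    refine Submodule.sum_mem _ fun u _ => Submodule.sum_mem _ fun v _ => ?_
    by_cases huv : u.1 = v.1
    · simp [hS u v huv]
    · have h1 := hmem (baseIndex n d)
      have hu := hmem (unitIndex hd u)
      have hv := hmem (unitIndex hd v)
      have hp := hmem (Function.update (unitIndex hd u) v.1 (unitSym hd v))
      rw [svMonomial_update (by rw [unitIndex, Function.update_of_ne (Ne.symm huv)]; rfl),
        prod_map_unitSym] at hp
      rw [svMonomial_unitIndex] at hu hv hp
      rw [svMonomial_baseIndex] at h1
      rw [C_mul']
      refine Submodule.smul_mem _ _ ?_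
      have : (X u - C (b u)) * (X v - C (b v)) = (X u * X v : MvPolynomial (SVChart n) ℂ) -
          b u • X v - b v • X u + (b u * b v) • 1 := by
        simp only [smul_eq_C_mul, C_mul]
        ring
      rw [this]
      exact Submodule.add_mem _ (Submodule.sub_mem _ (Submodule.sub_mem _ hp
        (Submodule.smul_mem _ _ hv)) (Submodule.smul_mem _ _ hu)) (Submodule.smul_mem _ _ h1)
  obtain ⟨h, hh⟩ := (Submodule.mem_span_range_iff_exists_fun ℂ).1 hsum
  exact ⟨h, by simp only [affineForm, C_mul', hh]⟩

/-- Every polynomial in the affine coordinates is the dehomogenization of a form on the ambient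
projective space. -/
theorem exists_homogenization (hd : ∀ i, 1 ≤ d i) (g : MvPolynomial (SVChart n) ℂ) :
    ∃ (G : MvPolynomial (SVIndex n d) ℂ) (k : ℕ), G.IsHomogeneous k ∧
      ∀ (c : ℂ) (b : SVChart n → ℂ), eval (c • chartVec d b) G = c ^ k * eval b g := by
  induction g using MvPolynomial.induction_on with
  | C a => exact ⟨C a, 0, isHomogeneous_C _ _, by simp⟩
  | add p q hp hq =>
    obtain ⟨G, k, hG, hGe⟩ := hp
    obtain ⟨G', k', hG', hGe'⟩ := hq
    -- The base coordinate of `c • chartVec d b` is c, so its powers equalize the degrees.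
    refine ⟨G * X (baseIndex n d) ^ k' + G' * X (baseIndex n d) ^ k, k + k', ?_, fun c b => ?_⟩
    · refine (hG.mul (isHomogeneous_X_pow _ _)).add ?_
      rw [add_comm k]
      exact hG'.mul (isHomogeneous_X_pow _ _)
    · simp only [map_add, map_mul, map_pow, eval_X, hGe, hGe', Pi.smul_apply, chartVec_baseIndex,
        smul_eq_mul]
      ring
  | mul_X p u hp =>
    obtain ⟨G, k, hG, hGe⟩ := hp
    refine ⟨G * X (unitIndex hd u), k + 1, hG.mul (isHomogeneous_X _ _), fun c b => ?_⟩
    simp only [map_mul, eval_X, hGe, Pi.smul_apply, smul_eq_mul, ← eval_svMonomial,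
      svMonomial_unitIndex]
    ring

/-- A hyperplane tangent at a point with nondegenerate Hessian has contact locus this point. -/
theorem contactLocus_eq_singleton_of_hessian (hd : ∀ i, 1 ≤ d i) {x H : ProjSpace (SVIndex n d)}
    {c : ℂ} {a : SVChart n → ℂ} (hc : c ≠ 0) (hx : x.coords = c • chartVec d a)
    (hxX : x ∈ segreVeronese n d) (hH : H ∈ tangentHyperplanes (segreVeronese n d) x)
    (hdet : (Matrix.of fun β γ => eval a (pderiv γ (pderiv β (affineForm H.coords)))).det ≠ 0) :
    contactLocus (segreVeronese n d) x H = {x} := by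
  obtain ⟨g, hga, hg⟩ := exists_isolating_of_jacobian_ne_zero a
    (fun β => pderiv β (affineForm H.coords)) (eval_pderiv_affineForm_of_mem hx hH) hdet
  obtain ⟨G, k, hG, hGe⟩ := exists_homogenization hd g
  -- The factor `X (baseIndex n d)` confines the neighbourhood to the chart, where G agrees with g
  -- up to a power of the scalar.
  refine contactLocus_eq_singleton (isOpen_eval_ne_zero
    (hG.mul (isHomogeneous_X ℂ (baseIndex n d)))) ⟨hxX, hH⟩ ?_ ?_
  · change eval x.coords _ ≠ 0
    rw [map_mul, eval_X, hx, hGe, Pi.smul_apply, chartVec_baseIndex, smul_eq_mul, mul_one]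
    exact mul_ne_zero (mul_ne_zero (pow_ne_zero _ hc) hga) hc
  · rintro y ⟨hyX, hyH⟩ hyV
    change eval y.coords _ ≠ 0 at hyV
    rw [map_mul, eval_X] at hyV
    obtain ⟨e, b, he, hy⟩ := exists_coords_eq_smul_chartVec hd hyX (right_ne_zero_of_mul hyV)
    have hGy := left_ne_zero_of_mul hyV
    rw [hy, hGe] at hGy
    have hba := hg b (eval_pderiv_affineForm_of_mem hy hyH) (right_ne_zero_of_mul hGy)
    subst hba
    exact (eq_mk_of_coords_eq_smul (chartVec_ne_zero b) hy).trans
      (eq_mk_of_coords_eq_smul (chartVec_ne_zero b) hx).symm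

/-! ### Nondegenerate Hessians and the conclusion -/

/-- The Hessian of the hyperplane section at a chart point, as a matrix of linear forms in the
coefficients of the hyperplane. -/
noncomputable def hessian (d : Fin m → ℕ) (a : SVChart n → ℂ) :
    Matrix (SVChart n) (SVChart n) (MvPolynomial (SVIndex n d) ℂ) :=
  Matrix.of fun β γ => ∑ J, X J * C (eval a (pderiv γ (pderiv β (svMonomial J))))

theorem eval_hessian_det (a : SVChart n → ℂ) (h : SVIndex n d → ℂ) :
    eval h (hessian d a).det =
      (Matrix.of fun β γ => eval a (pderiv γ (pderiv β (affineForm h)))).det := by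
  rw [RingHom.map_det]
  congr 1
  ext β γ
  simp [hessian, pderiv_affineForm]

theorem isHomogeneous_hessian_det (a : SVChart n → ℂ) :
    (hessian d a).det.IsHomogeneous (Fintype.card (SVChart n)) := by
  rw [Matrix.det_apply]
  refine IsHomogeneous.sum _ _ _ fun σ _ => ?_
  rw [Units.smul_def, zsmul_eq_mul, ← map_intCast (C : ℂ →+* MvPolynomial (SVIndex n d) ℂ)]
  refine IsHomogeneous.C_mul ?_ _
  have h := IsHomogeneous.prod Finset.univ (fun β => hessian d a (σ β) β) (fun _ => 1)
    fun β _ => IsHomogeneous.sum _ _ _ fun J _ => by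
      simpa using (isHomogeneous_X ℂ J).mul (isHomogeneous_C _ _)
  simpa using h

theorem eval_quadratic (b : SVChart n → ℂ) (S : Matrix (SVChart n) (SVChart n) ℂ) :
    eval b (∑ u, ∑ v, C (S u v) * ((X u - C (b u)) * (X v - C (b v)))) = 0 := by
  simp

theorem pderiv_quadratic (b : SVChart n → ℂ) {S : Matrix (SVChart n) (SVChart n) ℂ}
    (hS : S.IsSymm) (β : SVChart n) :
    pderiv β (∑ u, ∑ v, C (S u v) * ((X u - C (b u)) * (X v - C (b v)))) =
      2 * ∑ u, C (S β u) * (X u - C (b u)) := by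
  simp only [map_sum, pderiv_C_mul]
  simp only [Derivation.leibniz, map_sub, pderiv_C, sub_zero, pderiv_X,
    Pi.single_apply, smul_eq_mul, mul_ite, mul_one, mul_zero, mul_add, Finset.sum_add_distrib,
    Finset.sum_ite_eq', Finset.mem_univ, if_true, two_mul]
  congr 1
  · refine Finset.sum_congr rfl fun u _ => ?_
    rw [hS.apply]
  · rw [Finset.sum_comm]
    simp only [Finset.sum_ite_eq', Finset.mem_univ, if_true]

/-- The quadratic form of S centred at a vanishes there to second order, hence is tangent, and its
Hessian is 2S. -/
theorem exists_tangentHyperplane_hessian_ne_zero (hd : ∀ i, 1 ≤ d i) [Nonempty (SVChart n)]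
    (hn : ∀ i, 2 * n i ≤ ∑ j, n j) {x : ProjSpace (SVIndex n d)} {c : ℂ} {a : SVChart n → ℂ}
    (hc : c ≠ 0) (hx : x.coords = c • chartVec d a) :
    ∃ H ∈ tangentHyperplanes (segreVeronese n d) x, eval H.coords (hessian d a).det ≠ 0 := by
  obtain ⟨S, hSymm, hdet, hS⟩ := exists_symmetric_matrix_offDiagonal n hn
  obtain ⟨h, hh⟩ := exists_affineForm_eq_quadratic hd a S hS
  have hHess : eval h (hessian d a).det ≠ 0 := by
    rw [eval_hessian_det, hh]
    have : (Matrix.of fun β γ => eval a (pderiv γ (pderiv β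
        (∑ u, ∑ v, C (S u v) * ((X u - C (a u)) * (X v - C (a v))))))) = (2 : ℂ) • S := by
      ext β γ
      rw [Matrix.of_apply, pderiv_quadratic a hSymm, two_mul, map_add]
      simp [pderiv_X, Pi.single_apply, two_mul]
    rw [this, Matrix.det_smul]
    exact mul_ne_zero (pow_ne_zero _ two_ne_zero) hdet
  -- The determinant has positive degree because the chart has a coordinate, so it vanishes at 0.
  have h0 : h ≠ 0 := by
    rintro rfl
    apply hHess
    have := eval_smul_of_isHomogeneous (isHomogeneous_hessian_det (d := d) a) 0 0
    rwa [zero_smul, zero_pow Fintype.card_ne_zero, zero_mul] at this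
  obtain ⟨e, he, hek⟩ := exists_coords_mk h h0
  refine ⟨ProjSpace.mk h h0, mem_tangentHyperplanes_of_affineForm hd hc hx ?_ fun β => ?_, ?_⟩
  · rw [hek, affineForm_smul, map_mul, hh, eval_quadratic, mul_zero]
  · rw [hek, affineForm_smul, pderiv_C_mul, hh, pderiv_quadratic a hSymm]
    simp
  · rw [hek, eval_smul_of_isHomogeneous (isHomogeneous_hessian_det a)]
    exact mul_ne_zero (pow_ne_zero _ he) hHess

theorem forGeneral_topologicalKrullDim_contactLocus (hd : ∀ i, 1 ≤ d i) [Nonempty (SVChart n)]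
    (hn : ∀ i, 2 * n i ≤ ∑ j, n j) :
    ForGeneral (segreVeronese n d) fun x =>
      ForGeneral (tangentHyperplanes (segreVeronese n d) x) fun H =>
        topologicalKrullDim (contactLocus (segreVeronese n d) x H) = 0 := by
  refine ⟨_, isOpen_eval_ne_zero (isHomogeneous_X ℂ (baseIndex n d)), ?_, ?_⟩
  · refine ⟨_, mk_chartVec_mem 0, ?_⟩
    obtain ⟨c, hc, hcv⟩ := exists_coords_mk (chartVec d (0 : SVChart n → ℂ)) (chartVec_ne_zero 0)
    simpa [hcv, chartVec_baseIndex] using hc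
  · rintro x ⟨hxX, hx0⟩
    obtain ⟨c, a, hc, hx⟩ := exists_coords_eq_smul_chartVec hd hxX (by simpa using hx0)
    refine ⟨_, isOpen_eval_ne_zero (isHomogeneous_hessian_det a),
      exists_tangentHyperplane_hessian_ne_zero hd hn hc hx, ?_⟩
    rintro H ⟨hH, hdet⟩
    change eval H.coords _ ≠ 0 at hdet
    rw [eval_hessian_det] at hdet
    rw [contactLocus_eq_singleton_of_hessian hd hc hx hxX hH hdet]
    exact topologicalKrullDim_singleton x

end SegreVeronese

theorem mainTheorem10 (r : ℕ) (n d : Fin (r + 1) → ℕ)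
    (hn : ∀ i, 1 ≤ n i) (hd : ∀ i, 1 ≤ d i) (hmono : Monotone n)
    (hle : n (Fin.last r) ≤ ∑ i : Fin r, n i.castSucc) :
    ¬ IsOneWeaklyDefective (segreVeronese n d) ∧
    ForGeneral (segreVeronese n d) fun x =>
      ForGeneral (tangentHyperplanes (segreVeronese n d) x) fun H =>
        topologicalKrullDim (contactLocus (segreVeronese n d) x H) = 0 := by
  have : Nonempty (SVChart n) := ⟨⟨0, ⟨0, hn 0⟩⟩⟩
  -- By monotonicity the bound for the last, largest block gives it for all.
  have hn' : ∀ i, 2 * n i ≤ ∑ j, n j := by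
    intro i
    have := hmono (Fin.le_last i)
    rw [Fin.sum_univ_castSucc]
    omega
  have hgen := forGeneral_topologicalKrullDim_contactLocus hd hn'
  refine ⟨fun hdef => ?_, hgen⟩
  obtain ⟨x, _, h1, h2⟩ := ForGeneral.exists_and isPreirreducible_segreVeronese hdef hgen
  obtain ⟨H, _, h3, h4⟩ :=
    ForGeneral.exists_and (isPreirreducible_tangentHyperplanes _ x) h1 h2
  exact h3.ne' h4
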